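/- Let $D$ be an integral domain with quotient field $K$. A semistar operation $\star$ on $D$ is a map $E\mapsto E^\star$ on the set of nonzero $D$-submodules of $K$ such that, for all nonzero $D$-submodules $E,F$ of $K$ and all $0\ne x\in K$: $(xE)^\star=xE^\star$; $E\subseteq F$ implies $E^\star\subseteq F^\star$; $E\subseteq E^\star$ and $(E^\star)^\star=E^\star$. Its associated operation of finite type $\star_f$ is given by $E^{\star_f}=\bigcup\{F^\star \mid F\subseteq E \text{ a nonzero finitely generated } D\text{-submodule}\}$. A quasi-$\star$-ideal of $D$ is a nonzero ideal $I$ of $D$ with $I=I^\star\cap D$. The domain $D$ is $\star$-Noetherian if it satisfies the ascending chain condition on quasi-$\star$-ideals; it is a Prüfer $\star$-multiplication domain (P$\star$MD) if $(II^{-1})^{\star_f}=D^{\star_f}$ for every nonzero finitely generated ideal $I$ of $D$, where $I^{-1}=\{z\in K\mid zI\subseteq D\}$; and it is a $\star$-Dedekind domain if it is both $\star$-Noetherian and a P$\star$MD. For $f\in D[X]$ let $\boldsymbol{c}(f)$ be the ideal of $D$ generated by the coefficients of $f$. The set $N(\star)=\{h\in D[X]\mid h\neq 0,\ \boldsymbol{c}(h)^\star=D^\star\}$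 is multiplicatively closed, and the semistar Nagata ring is $\mathrm{Na}(D,\star)=D[X]_{N(\star)}\subseteq K(X)$. The Kronecker function ring $\mathrm{Kr}(D,\star)\subseteq K(X)$ consists of $0$ and of all $f/g$ with $f,g\in D[X]\setminus\{0\}$ for which there is $h\in D[X]\setminus\{0\}$ with $(\boldsymbol{c}(f)\boldsymbol{c}(h))^\star\subseteq(\boldsymbol{c}(g)\boldsymbol{c}(h))^\star$. Theorem. Let $\star$ be a semistar operation on $D$. The following are equivalent: 1. $D$ is a $\star$-Dedekind domain; 2. $\mathrm{Na}(D,\star)$ is a principal ideal domain; 3. $\mathrm{Na}(D,\star)$ is a Dedekind domain. Moreover, if these conditions hold, then $\mathrm{Na}(D,\star)=\mathrm{Kr}(D,\star)$. (Fields are counted as principal ideal domains and as Dedekind domains.) -/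

import Mathlib

open Polynomial
open scoped Pointwise

universe u v

/-- A semistar operation `E ↦ E^⋆` on the integral domain `D` with quotient field `K`.
It is a map on the nonzero `D`-submodules of `K`, extended to all submodules by `0^⋆ = 0`
(for `E = 0` the remaining axioms then hold trivially, and `E^⋆ ≠ 0` whenever `E ≠ 0`). -/
structure SemistarOperation (D : Type u) [CommRing D] [IsDomain D]
    (K : Type v) [Field K] [Algebra D K] [IsFractionRing D K] where
  /-- the underlying map `E ↦ E^⋆` -/
  toFun : Submodule D K → Submodule D K
  map_bot : toFun ⊥ = ⊥
  map_smul : ∀ (x : K) (E : Submodule D K), x ≠ 0 → toFun (x • E) = x • toFun E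
  mono : ∀ E F : Submodule D K, E ≤ F → toFun E ≤ toFun F
  le_toFun : ∀ E : Submodule D K, E ≤ toFun E
  idem : ∀ E : Submodule D K, toFun (toFun E) = toFun E

namespace SemistarOperation

section

variable {D : Type u} [CommRing D] [IsDomain D]
  {K : Type v} [Field K] [Algebra D K] [IsFractionRing D K]

instance : CoeFun (SemistarOperation D K) (fun _ => Submodule D K → Submodule D K) := ⟨toFun⟩

theorem mul_toFun_le (s : SemistarOperation D K) (E F : Submodule D K) :
    E * s F ≤ s (E * F) := by
  rw [Submodule.mul_le]
  intro x hx y hy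
  by_cases h0 : x = 0
  · simp [h0]
  · have h1 : x • F ≤ E * F := by
      intro z hz
      obtain ⟨w, hw, rfl⟩ := (Submodule.mem_smul_pointwise_iff_exists _ _ _).1 hz
      exact Submodule.mul_mem_mul hx hw
    have h2 := s.mono _ _ h1
    rw [s.map_smul x F h0] at h2
    exact h2 (Submodule.smul_mem_pointwise_smul y x _ hy)

/-- The underlying submodule of `E^{⋆_f}`: the union of all `F^⋆` with `F ⊆ E` finitely
generated. -/
def finiteTypeFun (s : SemistarOperation D K) (E : Submodule D K) : Submodule D K where
  carrier := {y | ∃ F : Submodule D K, F.FG ∧ F ≤ E ∧ y ∈ s F}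
  zero_mem' := ⟨⊥, Submodule.fg_bot, bot_le, zero_mem _⟩
  add_mem' := by
    rintro a b ⟨F, hF, hFE, ha⟩ ⟨G, hG, hGE, hb⟩
    exact ⟨F ⊔ G, hF.sup hG, sup_le hFE hGE,
      add_mem (s.mono _ _ le_sup_left ha) (s.mono _ _ le_sup_right hb)⟩
  smul_mem' := by
    rintro c a ⟨F, hF, hFE, ha⟩
    exact ⟨F, hF, hFE, Submodule.smul_mem _ c ha⟩

theorem mem_finiteTypeFun (s : SemistarOperation D K) (E : Submodule D K) (y : K) :
    y ∈ s.finiteTypeFun E ↔ ∃ F : Submodule D K, F.FG ∧ F ≤ E ∧ y ∈ s F := Iff.rfl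

theorem finiteTypeFun_mono (s : SemistarOperation D K) {E F : Submodule D K} (h : E ≤ F) :
    s.finiteTypeFun E ≤ s.finiteTypeFun F := by
  rintro y ⟨G, hG, hGE, hy⟩
  exact ⟨G, hG, hGE.trans h, hy⟩

theorem le_finiteTypeFun (s : SemistarOperation D K) (E : Submodule D K) :
    E ≤ s.finiteTypeFun E := by
  intro y hy
  exact ⟨Submodule.span D {y}, Submodule.fg_span_singleton y, by simpa using hy,
    s.le_toFun _ (Submodule.mem_span_singleton_self y)⟩

theorem exists_fg_of_le_finiteTypeFun (s : SemistarOperation D K) (E G : Submodule D K)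
    (hG : G.FG) (h : G ≤ s.finiteTypeFun E) :
    ∃ F : Submodule D K, F.FG ∧ F ≤ E ∧ G ≤ s F := by
  revert h
  induction G, hG using Submodule.fg_induction with
  | singleton x =>
    intro hx
    obtain ⟨F, hF, hFE, hxF⟩ := hx (Submodule.mem_span_singleton_self x)
    exact ⟨F, hF, hFE, by simpa using hxF⟩
  | sup M N _ _ hM hN =>
    intro h
    obtain ⟨F, hF, hFE, h1⟩ := hM (le_sup_left.trans h)
    obtain ⟨F', hF', hFE', h2⟩ := hN (le_sup_right.trans h)
    exact ⟨F ⊔ F', hF.sup hF', sup_le hFE hFE',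
      sup_le (h1.trans (s.mono _ _ le_sup_left)) (h2.trans (s.mono _ _ le_sup_right))⟩

theorem smul_finiteTypeFun_le (s : SemistarOperation D K) (x : K) (E : Submodule D K)
    (hx : x ≠ 0) : x • s.finiteTypeFun E ≤ s.finiteTypeFun (x • E) := by
  intro z hz
  obtain ⟨w, ⟨F, hF, hFE, hw⟩, rfl⟩ := (Submodule.mem_smul_pointwise_iff_exists _ _ _).1 hz
  refine ⟨x • F, hF.map _, Submodule.map_mono hFE, ?_⟩
  rw [s.map_smul x F hx]
  exact Submodule.smul_mem_pointwise_smul w x _ hw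

/-- The semistar operation of finite type `⋆_f` associated to `⋆`. -/
def finiteType (s : SemistarOperation D K) : SemistarOperation D K where
  toFun := s.finiteTypeFun
  map_bot := by
    rw [eq_bot_iff]
    rintro y ⟨F, -, hF, hy⟩
    rw [le_bot_iff.1 hF, s.map_bot] at hy
    exact hy
  map_smul := by
    intro x E hx
    refine le_antisymm ?_ (s.smul_finiteTypeFun_le x E hx)
    have h := s.smul_finiteTypeFun_le x⁻¹ (x • E) (inv_ne_zero hx)
    rw [inv_smul_smul₀ hx] at h
    intro y hy
    have h' := h (Submodule.smul_mem_pointwise_smul y x⁻¹ _ hy)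
    have h'' := Submodule.smul_mem_pointwise_smul _ x _ h'
    rwa [smul_inv_smul₀ hx] at h''
  mono := fun _ _ h => s.finiteTypeFun_mono h
  le_toFun := s.le_finiteTypeFun
  idem := by
    intro E
    refine le_antisymm ?_ (s.le_finiteTypeFun _)
    rintro y ⟨G, hG, hGE, hy⟩
    obtain ⟨F, hF, hFE, hGF⟩ := s.exists_fg_of_le_finiteTypeFun E G hG hGE
    refine ⟨F, hF, hFE, ?_⟩
    have h := s.mono _ _ hGF hy
    rwa [s.idem] at h

/-- A quasi-`⋆`-ideal of `D`: a nonzero ideal `I` of `D` with `I = I^⋆ ∩ D`. -/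
def IsQuasiIdeal (s : SemistarOperation D K) (I : Ideal D) : Prop :=
  I ≠ ⊥ ∧ (s (IsLocalization.coeSubmodule K I)).comap (Algebra.linearMap D K) = I

/-- `D` is `⋆`-Noetherian: the ascending chain condition on quasi-`⋆`-ideals. -/
def IsStarNoetherian (s : SemistarOperation D K) : Prop :=
  WellFoundedGT {I : Ideal D // s.IsQuasiIdeal I}

/-- The submodule `E` of `K` is `⋆`-invertible: `(E E⁻¹)^⋆ = D^⋆`, where
`E⁻¹ = (D :_K E) = {z ∈ K | zE ⊆ D}`. -/
def IsStarInvertible (s : SemistarOperation D K) (E : Submodule D K) : Prop :=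
  s (E * ((1 : Submodule D K) / E)) = s 1

/-- `D` is a Prüfer `⋆`-multiplication domain: every nonzero finitely generated ideal of `D` is
`⋆_f`-invertible. -/
def IsPruferMultiplicationDomain (s : SemistarOperation D K) : Prop :=
  ∀ I : Ideal D, I ≠ ⊥ → I.FG →
    s.finiteType.IsStarInvertible (IsLocalization.coeSubmodule K I)

/-- `D` is a `⋆`-Dedekind domain: it is `⋆`-Noetherian and a Prüfer `⋆`-multiplication domain. -/
def IsStarDedekind (s : SemistarOperation D K) : Prop :=
  s.IsStarNoetherian ∧ s.IsPruferMultiplicationDomain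

/-- If the ideals `I`, `J` satisfy `I^⋆ = D^⋆ = J^⋆`, then `(I J)^⋆ = D^⋆`. -/
theorem coe_mul_eq_one (s : SemistarOperation D K) (I J : Ideal D)
    (hI : s (IsLocalization.coeSubmodule K I) = s 1)
    (hJ : s (IsLocalization.coeSubmodule K J) = s 1) :
    s (IsLocalization.coeSubmodule K (I * J)) = s 1 := by
  rw [IsLocalization.coeSubmodule_mul]
  set E := IsLocalization.coeSubmodule K I
  set F := IsLocalization.coeSubmodule K J
  have hE : E ≤ 1 := by
    rw [← IsLocalization.coeSubmodule_top]
    exact IsLocalization.coeSubmodule_mono _ le_top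
  have hF : F ≤ 1 := by
    rw [← IsLocalization.coeSubmodule_top]
    exact IsLocalization.coeSubmodule_mono _ le_top
  refine le_antisymm (s.mono _ _ ((mul_le_mul' hE hF).trans (by simp))) ?_
  have h1 : E ≤ s (E * F) := by
    calc E = E * 1 := (mul_one E).symm
      _ ≤ E * s F := by
        rw [hJ]
        exact mul_le_mul' le_rfl (s.le_toFun 1)
      _ ≤ s (E * F) := s.mul_toFun_le E F
  have h2 := s.mono _ _ h1
  rwa [s.idem, hI] at h2

/-- The multiplicative set `N(⋆) = {h ∈ D[X] | h ≠ 0, c(h)^⋆ = D^⋆}`, where `c(h)` is the ideal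
of `D` generated by the coefficients of `h`. -/
noncomputable def nagataSubmonoid (s : SemistarOperation D K) : Submonoid D[X] where
  carrier := {h | h ≠ 0 ∧ s (IsLocalization.coeSubmodule K h.contentIdeal) = s 1}
  one_mem' := ⟨one_ne_zero, by simp⟩
  mul_mem' := by
    rintro f g ⟨hf0, hf⟩ ⟨hg0, hg⟩
    refine ⟨mul_ne_zero hf0 hg0, ?_⟩
    obtain ⟨n, hn⟩ := Ideal.exists_pow_le_of_le_radical_of_fg
      (Polynomial.mul_contentIdeal_le_radical_contentIdeal_mul (p := f) (q := g))
      (f.contentIdeal_FG.mul g.contentIdeal_FG)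
    have hpow : ∀ m : ℕ, s (IsLocalization.coeSubmodule K
        ((f.contentIdeal * g.contentIdeal) ^ m)) = s 1 := by
      intro m
      induction m with
      | zero => simp [Ideal.one_eq_top]
      | succ k ih =>
        rw [pow_succ]
        exact s.coe_mul_eq_one _ _ ih (s.coe_mul_eq_one _ _ hf hg)
    refine le_antisymm ?_ ?_
    · rw [← IsLocalization.coeSubmodule_top (R := D)]
      exact s.mono _ _ (IsLocalization.coeSubmodule_mono _ le_top)
    · rw [← hpow n]
      exact s.mono _ _ (IsLocalization.coeSubmodule_mono _ hn)

theorem mem_nagataSubmonoid (s : SemistarOperation D K) (h : D[X]) :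
    h ∈ s.nagataSubmonoid ↔
      h ≠ 0 ∧ s (IsLocalization.coeSubmodule K h.contentIdeal) = s 1 := Iff.rfl

theorem nagataSubmonoid_le (s : SemistarOperation D K) :
    s.nagataSubmonoid ≤ nonZeroDivisors D[X] :=
  fun _ h => mem_nonZeroDivisors_of_ne_zero h.1

/-- The semistar Nagata ring `Na(D,⋆) = D[X]_{N(⋆)}`, as a subring of the quotient field of `D[X]`
(which is `K(X)`). -/
noncomputable def nagataRing (s : SemistarOperation D K) : Subalgebra D[X] (FractionRing D[X]) :=
  Localization.subalgebra.ofField (FractionRing D[X]) s.nagataSubmonoid s.nagataSubmonoid_le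

theorem isLocalization_nagataRing (s : SemistarOperation D K) :
    IsLocalization s.nagataSubmonoid s.nagataRing :=
  Localization.subalgebra.isLocalization_ofField _ _ s.nagataSubmonoid_le

theorem mem_nagataRing (s : SemistarOperation D K) (x : FractionRing D[X]) :
    x ∈ s.nagataRing ↔ ∃ f : D[X], ∃ h : D[X], h ∈ s.nagataSubmonoid ∧
      x = algebraMap D[X] (FractionRing D[X]) f / algebraMap D[X] (FractionRing D[X]) h := by
  simp only [div_eq_mul_inv]
  constructor
  · rintro ⟨f, h, hh, rfl⟩
    exact ⟨f, h, hh, rfl⟩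
  · rintro ⟨f, h, hh, rfl⟩
    exact ⟨f, h, hh, rfl⟩

/-- The (underlying set of the) Kronecker function ring `Kr(D,⋆)` inside the quotient field of
`D[X]` (which is `K(X)`): the zero element and the fractions `f/g` of nonzero `f, g ∈ D[X]` such
that `(c(f)c(h))^⋆ ⊆ (c(g)c(h))^⋆` for some nonzero `h ∈ D[X]`. -/
def kroneckerFunctionRing (s : SemistarOperation D K) : Set (FractionRing D[X]) :=
  {x | ∃ f g : D[X], f ≠ 0 ∧ g ≠ 0 ∧
    x = algebraMap D[X] (FractionRing D[X]) f / algebraMap D[X] (FractionRing D[X]) g ∧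
    ∃ h : D[X], h ≠ 0 ∧
      s (IsLocalization.coeSubmodule K (f.contentIdeal * h.contentIdeal)) ≤
        s (IsLocalization.coeSubmodule K (g.contentIdeal * h.contentIdeal))} ∪ {0}

end

end SemistarOperation

/-! Contents of polynomials carry information between `D` and `Na(D,⋆)`. In a P⋆MD, `c(f) ⊆ c(g)^⋆`
forces `g` to divide `f` in the Nagata ring (`exists_mul_eq_mul`). Hence the contraction `B` to
`D[X]` of an ideal of `Na(D,⋆)` contains all coefficients of its members. The ⋆-Noetherian property
gives a finitely generated `J ⊆ B ∩ D` with `B ∩ D ⊆ J^⋆`, and a polynomial with content `J`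
generates the ideal.

Conversely, let `Na(D,⋆)` be Dedekind. Extension of ideals is strictly increasing on quasi-⋆-ideals,
so the chain condition descends. For `0 ≠ a ∈ I`, the extension of `I` divides `(a)`, and for
finitely generated `I` the cofactor lies in the extension of `(a) : I`. Clearing denominators gives
`au ∈ (I((a) : I))[X]` with `c(u)^⋆ = D^⋆`, which is ⋆_f-invertibility of `I`.

For the Kronecker function ring, `c(h)` is cancelled by invertibility and the divisibility criterion
applies again. -/

namespace SemistarOperation

variable {D : Type u} [CommRing D] [IsDomain D]
  {K : Type v} [Field K] [Algebra D K] [IsFractionRing D K]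

open IsLocalization (coeSubmodule)

/-! ### Closures and invertibility expressed through ideals of `D` -/

omit [IsDomain D] [IsFractionRing D K] in
theorem coeSubmodule_le_one (I : Ideal D) : coeSubmodule K I ≤ 1 := by
  rw [← IsLocalization.coeSubmodule_top (R := D)]
  exact IsLocalization.coeSubmodule_mono _ le_top

theorem toFun_le_iff (s : SemistarOperation D K) {E F : Submodule D K} :
    s E ≤ s F ↔ E ≤ s F := by
  refine ⟨(s.le_toFun E).trans, fun h => ?_⟩
  have := s.mono _ _ h
  rwa [s.idem] at this

theorem toFun_eq_toFun_one_iff (s : SemistarOperation D K) {E : Submodule D K} (hE : E ≤ 1) :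
    s E = s 1 ↔ (1 : K) ∈ s E := by
  constructor
  · intro h
    rw [h]
    exact s.le_toFun 1 (Submodule.one_le.1 le_rfl)
  · intro h
    refine le_antisymm (s.mono _ _ hE) (s.toFun_le_iff.2 ?_)
    rwa [Submodule.one_eq_span, Submodule.span_singleton_le_iff_mem]

omit [IsDomain D] [IsFractionRing D K] in
theorem algebraMap_smul_coeSubmodule (a : D) (I : Ideal D) :
    algebraMap D K a • coeSubmodule K I = coeSubmodule K (Ideal.span {a} * I) := by
  ext z
  rw [Submodule.mem_smul_pointwise_iff_exists, IsLocalization.mem_coeSubmodule]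
  constructor
  · rintro ⟨_, ⟨y, hy, rfl⟩, rfl⟩
    exact ⟨a * y, Ideal.mul_mem_mul (Ideal.mem_span_singleton_self a) hy, by simp⟩
  · rintro ⟨y, hy, rfl⟩
    obtain ⟨w, hw, rfl⟩ := Ideal.mem_span_singleton_mul.1 hy
    exact ⟨algebraMap D K w, ⟨w, hw, rfl⟩, by simp⟩

omit [IsDomain D] in
theorem algebraMap_mem_smul_iff {a : D} (ha : a ≠ 0) (E : Submodule D K) :
    algebraMap D K a ∈ algebraMap D K a • E ↔ (1 : K) ∈ E := by
  have ha' : algebraMap D K a ≠ 0 := by simpa using ha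
  rw [Submodule.mem_smul_pointwise_iff_exists]
  constructor
  · rintro ⟨z, hz, h⟩
    rw [smul_eq_mul] at h
    have : z = 1 := mul_left_cancel₀ ha' (by rw [h, mul_one])
    rwa [← this]
  · intro h
    exact ⟨1, h, by simp⟩

-- Since `a ∈ I`, every `w ∈ I⁻¹` has `aw ∈ D`; scaling by `a` thus replaces the fractional inverse
-- by an ideal of `D`.
omit [IsDomain D] in
theorem coeSubmodule_colon {a : D} (ha : a ≠ 0) {I : Ideal D} (haI : a ∈ I) :
    coeSubmodule K ((Ideal.span {a}).colon (I : Set D)) =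
      algebraMap D K a • ((1 : Submodule D K) / coeSubmodule K I) := by
  have ha' : algebraMap D K a ≠ 0 := by simpa using ha
  ext z
  rw [Submodule.mem_smul_pointwise_iff_exists, IsLocalization.mem_coeSubmodule]
  constructor
  · rintro ⟨y, hy, rfl⟩
    refine ⟨algebraMap D K y / algebraMap D K a, ?_, by
      rw [smul_eq_mul]; field_simp⟩
    rw [Submodule.mem_div_iff_forall_mul_mem]
    rintro _ ⟨b, hb, rfl⟩
    have h := Submodule.mem_colon.1 hy b hb
    obtain ⟨e, he⟩ := Ideal.mem_span_singleton'.1 h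
    refine Submodule.mem_one.2 ⟨e, ?_⟩
    have he' := congrArg (algebraMap D K) he
    simp only [map_mul, smul_eq_mul] at he'
    rw [Algebra.linearMap_apply]
    field_simp
    exact he'
  · rintro ⟨w, hw, rfl⟩
    rw [Submodule.mem_div_iff_forall_mul_mem] at hw
    obtain ⟨y, hy⟩ := Submodule.mem_one.1 (hw _ ⟨a, haI, rfl⟩)
    rw [Algebra.linearMap_apply] at hy
    refine ⟨y, Submodule.mem_colon.2 fun b hb => ?_, by rw [hy, smul_eq_mul, mul_comm]⟩
    obtain ⟨e, he⟩ := Submodule.mem_one.1 (hw _ ⟨b, hb, rfl⟩)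
    rw [Algebra.linearMap_apply] at he
    refine Ideal.mem_span_singleton'.2 ⟨e, IsFractionRing.injective D K ?_⟩
    rw [smul_eq_mul, map_mul, map_mul, he, hy]
    ring

/-- An ideal `I` is `⋆`-invertible if and only if `a ∈ (I ((a) : I))^⋆`, where `0 ≠ a ∈ I`. -/
theorem isStarInvertible_coeSubmodule_iff (s : SemistarOperation D K) {a : D} (ha : a ≠ 0)
    {I : Ideal D} (haI : a ∈ I) :
    s.IsStarInvertible (coeSubmodule K I) ↔
      algebraMap D K a ∈ s (coeSubmodule K (I * (Ideal.span {a}).colon (I : Set D))) := by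
  have ha' : algebraMap D K a ≠ 0 := by simpa using ha
  have h : coeSubmodule K (I * (Ideal.span {a}).colon (I : Set D)) =
      algebraMap D K a • (coeSubmodule K I * ((1 : Submodule D K) / coeSubmodule K I)) := by
    rw [IsLocalization.coeSubmodule_mul, coeSubmodule_colon ha haI, mul_smul_comm]
  rw [h, s.map_smul _ _ ha', algebraMap_mem_smul_iff ha]
  exact s.toFun_eq_toFun_one_iff Submodule.mul_one_div_le_one

theorem mem_finiteType_coeSubmodule_iff (s : SemistarOperation D K) (I : Ideal D) (x : K) :
    x ∈ s.finiteType (coeSubmodule K I) ↔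
      ∃ J : Ideal D, J.FG ∧ J ≤ I ∧ x ∈ s (coeSubmodule K J) := by
  constructor
  · rintro ⟨F, hF, hFI, hx⟩
    have hF' : coeSubmodule K (F.comap (Algebra.linearMap D K)) = F :=
      Submodule.map_comap_eq_self (hFI.trans LinearMap.map_le_range)
    refine ⟨F.comap (Algebra.linearMap D K), ?_, ?_, by rwa [hF']⟩
    · refine (IsLocalization.coeSubmodule_fg K (IsFractionRing.injective D K) _).1 ?_
      rwa [hF']
    · rw [← IsFractionRing.coeSubmodule_le_coeSubmodule (K := K), hF']
      exact hFI
  · rintro ⟨J, hJ, hJI, hx⟩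
    exact ⟨coeSubmodule K J, Submodule.FG.map _ hJ, IsLocalization.coeSubmodule_mono _ hJI, hx⟩

end SemistarOperation

/-! ### Finitely generated ideals and contents of polynomials -/

theorem Ideal.exists_fg_le_mul {D : Type*} [CommRing D] {I L J : Ideal D} (hJ : J.FG)
    (h : J ≤ I * L) : ∃ M : Ideal D, M.FG ∧ M ≤ L ∧ J ≤ I * M := by
  revert h
  induction J, hJ using Submodule.fg_induction with
  | singleton x =>
    intro h
    obtain ⟨T, T', hT, hT', hx⟩ := Submodule.mem_span_mul_finite_of_mem_mul
      (h (Submodule.mem_span_singleton_self x))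
    refine ⟨Ideal.span T', ⟨T', rfl⟩, Ideal.span_le.2 hT', ?_⟩
    rw [Submodule.span_singleton_le_iff_mem]
    refine (Submodule.span_le.2 ?_ : Submodule.span D ((T : Set D) * (T' : Set D)) ≤ _) hx
    rintro _ ⟨a, ha, b, hb, rfl⟩
    exact Ideal.mul_mem_mul (hT ha) (Ideal.subset_span hb)
  | sup A B _ _ hA hB =>
    intro h
    obtain ⟨M, hM, hML, h1⟩ := hA (le_sup_left.trans h)
    obtain ⟨M', hM', hML', h2⟩ := hB (le_sup_right.trans h)
    exact ⟨M ⊔ M', Submodule.FG.sup hM hM', sup_le hML hML',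
      sup_le (h1.trans (Ideal.mul_mono_right le_sup_left))
        (h2.trans (Ideal.mul_mono_right le_sup_right))⟩

theorem Polynomial.contentIdeal_le_iff {D : Type*} [CommRing D] {f : D[X]} {I : Ideal D} :
    f.contentIdeal ≤ I ↔ ∀ n, f.coeff n ∈ I := by
  refine ⟨fun h n => h (f.coeff_mem_contentIdeal n), fun h => Ideal.span_le.2 ?_⟩
  intro x hx
  obtain ⟨n, -, rfl⟩ := Polynomial.mem_coeffs_iff.1 hx
  exact h n

theorem Polynomial.contentIdeal_C_mul {D : Type*} [CommRing D] (a : D) (f : D[X]) :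
    (C a * f).contentIdeal = Ideal.span {a} * f.contentIdeal := by
  refine le_antisymm ?_ ?_
  · rw [← contentIdeal_C]
    exact contentIdeal_mul_le_mul_contentIdeal _ _
  · rw [Ideal.span_singleton_mul_le_iff]
    have h : f.contentIdeal ≤ ((C a * f).contentIdeal).colon {a} := by
      rw [contentIdeal_le_iff]
      intro n
      rw [Submodule.mem_colon_singleton, smul_eq_mul, mul_comm (f.coeff n), ← coeff_C_mul]
      exact coeff_mem_contentIdeal _ n
    intro z hz
    have := Submodule.mem_colon_singleton.1 (h hz)
    rwa [smul_eq_mul, mul_comm z] at this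

/-- For a finitely generated ideal `M` and a polynomial `g` there is a polynomial `j` with
coefficients in `M` and such that `c(g) M ⊆ c(g j)`. -/
theorem Polynomial.exists_contentIdeal_mul_le {D : Type*} [CommRing D] (g : D[X]) {M : Ideal D}
    (hM : M.FG) :
    ∃ j : D[X], j.contentIdeal ≤ M ∧ g.contentIdeal * M ≤ (g * j).contentIdeal := by
  induction M, hM using Submodule.fg_induction with
  | singleton x =>
    refine ⟨C x, (contentIdeal_C x).le, ?_⟩
    rw [mul_comm g, contentIdeal_C_mul, mul_comm]
  | sup A B _ _ hA hB =>
    obtain ⟨p, hpA, hp⟩ := hA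
    obtain ⟨q, hqB, hq⟩ := hB
    -- Shifting `q` past the degree of `g * p` keeps the coefficients of `g * p` and `g * q` in
    -- disjoint positions, so nothing cancels.
    set N := (g * p).natDegree + 1
    refine ⟨p + q * X ^ N, ?_, ?_⟩
    · rw [contentIdeal_le_iff]
      intro n
      rw [coeff_add, coeff_mul_X_pow']
      refine add_mem (Submodule.mem_sup_left (hpA (coeff_mem_contentIdeal _ n))) ?_
      split_ifs
      · exact Submodule.mem_sup_right (hqB (coeff_mem_contentIdeal _ _))
      · exact zero_mem _
    · have hc : ∀ n, (g * (p + q * X ^ N)).coeff n =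
          (g * p).coeff n + if N ≤ n then (g * q).coeff (n - N) else 0 := by
        intro n
        rw [mul_add, ← mul_assoc, coeff_add, coeff_mul_X_pow']
      have h1 : (g * p).contentIdeal ≤ (g * (p + q * X ^ N)).contentIdeal := by
        rw [contentIdeal_le_iff]
        intro n
        by_cases hn : N ≤ n
        · rw [coeff_eq_zero_of_natDegree_lt (by omega)]
          exact zero_mem _
        · have := coeff_mem_contentIdeal (g * (p + q * X ^ N)) n
          rwa [hc, if_neg hn, add_zero] at this
      have h2 : (g * q).contentIdeal ≤ (g * (p + q * X ^ N)).contentIdeal := by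
        rw [contentIdeal_le_iff]
        intro n
        have := coeff_mem_contentIdeal (g * (p + q * X ^ N)) (n + N)
        rwa [hc, if_pos (by omega), coeff_eq_zero_of_natDegree_lt (by omega), zero_add,
          Nat.add_sub_cancel] at this
      rw [Ideal.mul_sup]
      exact sup_le (hp.trans h1) (hq.trans h2)

theorem Polynomial.exists_contentIdeal_eq {D : Type*} [CommRing D] {M : Ideal D} (hM : M.FG) :
    ∃ j : D[X], j.contentIdeal = M := by
  obtain ⟨j, h1, h2⟩ := exists_contentIdeal_mul_le 1 hM
  refine ⟨j, le_antisymm h1 ?_⟩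
  simpa using h2

/-! ### Divisibility in the Nagata ring; finiteness from the chain condition -/

namespace SemistarOperation

variable {D : Type u} [CommRing D] [IsDomain D]
  {K : Type v} [Field K] [Algebra D K] [IsFractionRing D K]

open IsLocalization (coeSubmodule)

theorem mem_nagataSubmonoid_of_one_mem (s : SemistarOperation D K) {h : D[X]}
    (h1 : (1 : K) ∈ s (coeSubmodule K h.contentIdeal)) : h ∈ s.nagataSubmonoid := by
  refine ⟨?_, (s.toFun_eq_toFun_one_iff (coeSubmodule_le_one _)).2 h1⟩
  rintro rfl
  rw [contentIdeal_zero, IsLocalization.coeSubmodule_bot, s.map_bot, Submodule.mem_bot] at h1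
  exact one_ne_zero h1

/-- In a Prüfer `⋆`-multiplication domain, `c(f) ⊆ c(g)^⋆` implies `f / g ∈ Na(D,⋆)`. -/
theorem IsPruferMultiplicationDomain.exists_mul_eq_mul {s : SemistarOperation D K}
    (hs : s.IsPruferMultiplicationDomain) {f g : D[X]} (hg : g ≠ 0)
    (hfg : coeSubmodule K f.contentIdeal ≤ s (coeSubmodule K g.contentIdeal)) :
    ∃ p : D[X], ∃ u ∈ s.nagataSubmonoid, f * u = p * g := by
  -- `I` has the same ⋆-closure as `c(g)`, yet a multiplier from `(a) : I` serves `f` and `g` at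
  -- once.
  set I : Ideal D := f.contentIdeal ⊔ g.contentIdeal with hI
  have hgI : g.contentIdeal ≤ I := le_sup_right
  have hIs : coeSubmodule K I ≤ s (coeSubmodule K g.contentIdeal) := by
    rw [hI, IsLocalization.coeSubmodule_sup]
    exact sup_le hfg (s.le_toFun _)
  set a : D := g.leadingCoeff
  have ha : a ≠ 0 := leadingCoeff_ne_zero.2 hg
  have haI : a ∈ I := hgI (coeff_mem_contentIdeal _ _)
  have hinv := hs I (fun h => ha (by simpa [h] using haI))
    (Submodule.FG.sup f.contentIdeal_FG g.contentIdeal_FG)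
  rw [isStarInvertible_coeSubmodule_iff _ ha haI, mem_finiteType_coeSubmodule_iff] at hinv
  obtain ⟨J, hJ, hJI, haJ⟩ := hinv
  obtain ⟨M, hM, hML, hJM⟩ := Ideal.exists_fg_le_mul hJ hJI
  obtain ⟨j, hjM, hgj⟩ := exists_contentIdeal_mul_le g hM
  -- The coefficients of `j` lie in `(a) : I`, so `f * j` and `g * j` are divisible by `a`; the
  -- quotients are the required `p` and `u`.
  have hdvd : ∀ q : D[X], q.contentIdeal ≤ I → ∃ r, q * j = C a * r := by
    intro q hq
    refine (C_dvd_iff_dvd_coeff _ _).2 fun n => Ideal.mem_span_singleton.1 ?_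
    have h1 : (q * j).contentIdeal ≤ I * M :=
      (contentIdeal_mul_le_mul_contentIdeal _ _).trans (Ideal.mul_mono hq hjM)
    have h2 : I * M ≤ Ideal.span {a} := by
      rw [Ideal.mul_le]
      intro x hx y hy
      have := Submodule.mem_colon.1 (hML hy) x hx
      rwa [smul_eq_mul, mul_comm] at this
    exact h2 (h1 (coeff_mem_contentIdeal _ n))
  obtain ⟨p, hp⟩ := hdvd f le_sup_left
  obtain ⟨u, hu⟩ := hdvd g le_sup_right
  refine ⟨p, u, s.mem_nagataSubmonoid_of_one_mem ?_, ?_⟩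
  · have ha' : algebraMap D K a ≠ 0 := by simpa using ha
    rw [← algebraMap_mem_smul_iff ha, ← s.map_smul _ _ ha', algebraMap_smul_coeSubmodule,
      ← contentIdeal_C_mul, ← hu]
    -- `J ⊆ I M ⊆ (c(g) M)^⋆ ⊆ c(g j)^⋆`, hence `a ∈ c(g j)^⋆ = a c(u)^⋆`.
    have h1 : coeSubmodule K J ≤ s (coeSubmodule K (g.contentIdeal * M)) := by
      refine (IsLocalization.coeSubmodule_mono _ hJM).trans ?_
      rw [mul_comm, IsLocalization.coeSubmodule_mul]
      refine (mul_le_mul' le_rfl hIs).trans ((s.mul_toFun_le _ _).trans ?_)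
      rw [← IsLocalization.coeSubmodule_mul, mul_comm]
    exact s.mono _ _ (IsLocalization.coeSubmodule_mono _ hgj) (s.toFun_le_iff.2 h1 haJ)
  · have hCa : C a ≠ 0 := C_ne_zero.2 ha
    refine mul_left_cancel₀ hCa ?_
    calc C a * (f * u) = f * (C a * u) := by ring
      _ = f * (g * j) := by rw [hu]
      _ = g * (f * j) := by ring
      _ = g * (C a * p) := by rw [hp]
      _ = C a * (p * g) := by ring

/-- The quasi-`⋆`-ideal `I^⋆ ∩ D` attached to a nonzero ideal `I`. -/
theorem isQuasiIdeal_comap (s : SemistarOperation D K) {I : Ideal D} (hI : I ≠ ⊥) :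
    s.IsQuasiIdeal ((s (coeSubmodule K I)).comap (Algebra.linearMap D K)) := by
  have hle : I ≤ (s (coeSubmodule K I)).comap (Algebra.linearMap D K) := fun x hx =>
    s.le_toFun _ ⟨x, hx, rfl⟩
  refine ⟨fun h => hI (le_bot_iff.1 (hle.trans h.le)), le_antisymm ?_ ?_⟩
  · refine Submodule.comap_mono (s.toFun_le_iff.2 ?_)
    exact Submodule.map_comap_le _ _
  · exact Submodule.comap_mono (s.mono _ _ (IsLocalization.coeSubmodule_mono _ hle))

/-- Choose a maximal `J^⋆ ∩ D` among finitely generated nonzero `J ⊆ I`; an `x ∈ I` outside `J^⋆`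
could be adjoined to enlarge it. Quasi-⋆-ideals are nonzero, so `I = 0` is separate. -/
theorem IsStarNoetherian.exists_fg_le {s : SemistarOperation D K} (hs : s.IsStarNoetherian)
    (I : Ideal D) :
    ∃ J : Ideal D, J.FG ∧ J ≤ I ∧ coeSubmodule K I ≤ s (coeSubmodule K J) := by
  by_cases hI : I = ⊥
  · subst hI
    exact ⟨⊥, Submodule.fg_bot, le_rfl, s.le_toFun _⟩
  obtain ⟨b, hb, hb0⟩ := Submodule.exists_mem_ne_zero_of_ne_bot hI
  have hs' : WellFoundedGT {I : Ideal D // s.IsQuasiIdeal I} := hs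
  let S : Set {I : Ideal D // s.IsQuasiIdeal I} :=
    {Q | ∃ J : Ideal D, J.FG ∧ J ≤ I ∧
      (s (coeSubmodule K J)).comap (Algebra.linearMap D K) = Q.1}
  have hne : S.Nonempty :=
    ⟨⟨_, s.isQuasiIdeal_comap (I := Ideal.span {b}) (by simpa using hb0)⟩, Ideal.span {b},
      Submodule.fg_span_singleton b, by simpa [Ideal.span_le] using hb, rfl⟩
  obtain ⟨Q, ⟨J, hJ, hJI, hQ⟩, hmax⟩ := hs'.wf.has_min S hne
  refine ⟨J, hJ, hJI, ?_⟩
  rintro _ ⟨x, hx, rfl⟩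
  by_contra hxJ
  have hx0 : x ≠ 0 := by
    rintro rfl
    exact hxJ (by simp)
  have hJx : J ⊔ Ideal.span {x} ≠ ⊥ := by
    intro h
    have : x ∈ J ⊔ Ideal.span {x} := Submodule.mem_sup_right (Ideal.mem_span_singleton_self x)
    rw [h] at this
    exact hx0 this
  refine hmax ⟨_, s.isQuasiIdeal_comap hJx⟩ ⟨_, Submodule.FG.sup hJ (Submodule.fg_span_singleton x),
    sup_le hJI (by simpa [Ideal.span_le] using hx), rfl⟩ ?_
  change Q.1 < _
  rw [← hQ]
  refine lt_of_le_of_ne (Submodule.comap_mono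
    (s.mono _ _ (IsLocalization.coeSubmodule_mono _ le_sup_left))) fun h => hxJ ?_
  have : x ∈ (s (coeSubmodule K (J ⊔ Ideal.span {x}))).comap (Algebra.linearMap D K) :=
    s.le_toFun _ ⟨x, Submodule.mem_sup_right (Ideal.mem_span_singleton_self x), rfl⟩
  exact h.ge this

/-! ### Transfer between `D` and the localization at `N(⋆)` -/

section Localization

variable (A : Type*) [CommRing A] [Algebra D[X] A]

theorem IsStarDedekind.isPrincipalIdealRing_localization {s : SemistarOperation D K}
    [IsLocalization s.nagataSubmonoid A] (hs : s.IsStarDedekind) : IsPrincipalIdealRing A := by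
  refine ⟨fun b => ?_⟩
  have hkey : ∀ f g : D[X], g ≠ 0 →
      coeSubmodule K f.contentIdeal ≤ s (coeSubmodule K g.contentIdeal) →
      algebraMap D[X] A f ∈ Ideal.span {algebraMap D[X] A g} := by
    intro f g hg hfg
    obtain ⟨p, u, hu, h⟩ := hs.2.exists_mul_eq_mul hg hfg
    have h' := congrArg (algebraMap D[X] A) h
    rw [map_mul, map_mul] at h'
    refine (Ideal.mul_unit_mem_iff_mem _ (IsLocalization.map_units A ⟨u, hu⟩)).1 ?_
    exact h' ▸ Ideal.mul_mem_left _ _ (Ideal.mem_span_singleton_self _)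
  set B : Ideal D[X] := b.comap (algebraMap D[X] A) with hB
  have hBb : B.map (algebraMap D[X] A) = b := IsLocalization.map_under s.nagataSubmonoid A b
  -- Each coefficient generates an ideal inside `c(f)`, so `f` divides it in `A`.
  have hcoeff : ∀ f ∈ B, ∀ n, C (f.coeff n) ∈ B := by
    intro f hf n
    by_cases hf0 : f = 0
    · simp [hf0]
    have h := hkey (C (f.coeff n)) f hf0 (by
      refine le_trans (IsLocalization.coeSubmodule_mono _ ?_) (s.le_toFun _)
      rw [contentIdeal_C, Ideal.span_singleton_le_iff_mem]
      exact coeff_mem_contentIdeal _ n)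
    exact (Ideal.span_singleton_le_iff_mem b).2 hf h
  obtain ⟨J, hJ, hJB, hBJ⟩ := hs.1.exists_fg_le (B.comap C)
  obtain ⟨g, hg⟩ := exists_contentIdeal_eq hJ
  have hgB : g ∈ B := by
    have : g ∈ (B.comap C).map C :=
      Ideal.mem_map_C_iff.2 fun n => hJB (hg ▸ coeff_mem_contentIdeal g n)
    exact Ideal.map_comap_le this
  have hfg : ∀ f ∈ B, coeSubmodule K f.contentIdeal ≤ s (coeSubmodule K g.contentIdeal) := by
    intro f hf
    rw [hg]
    refine le_trans (IsLocalization.coeSubmodule_mono _ ?_) hBJ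
    exact contentIdeal_le_iff.2 (hcoeff f hf)
  refine ⟨algebraMap D[X] A g, le_antisymm ?_ ?_⟩
  · rw [← hBb, Ideal.map_le_iff_le_comap]
    intro f hf
    by_cases hg0 : g = 0
    · have h := hfg f hf
      rw [hg0, contentIdeal_zero, IsLocalization.coeSubmodule_bot, s.map_bot, le_bot_iff] at h
      have h0 : f.contentIdeal = ⊥ := by
        apply IsFractionRing.coeSubmodule_injective D K
        simpa using h
      rw [(contentIdeal_eq_bot_iff f).1 h0]
      exact zero_mem _
    · exact hkey f g hg0 (hfg f hf)
  · exact (Ideal.span_singleton_le_iff_mem _).2 hgB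

theorem isStarNoetherian_of_isNoetherianRing_localization (s : SemistarOperation D K)
    [IsLocalization s.nagataSubmonoid A] [IsNoetherianRing A] : s.IsStarNoetherian := by
  let φ : Ideal D → Ideal A := fun I => (I.map C).map (algebraMap D[X] A)
  have hmono : Monotone φ := fun I J h => Ideal.map_mono (Ideal.map_mono h)
  have hle : ∀ I J : Ideal D, s.IsQuasiIdeal J → φ I ≤ φ J → I ≤ J := by
    intro I J hJ h x hx
    have h1 : algebraMap D[X] A (C x) ∈ φ J :=
      h (Ideal.mem_map_of_mem _ (Ideal.mem_map_of_mem _ hx))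
    -- Here `xu ∈ J[X]`, so `x c(u) ⊆ J`; as `c(u)^⋆ = D^⋆`, taking closures gives `x ∈ J^⋆ ∩ D =
    -- J`.
    obtain ⟨u, hu, hxu⟩ := (IsLocalization.algebraMap_mem_map_algebraMap_iff
      s.nagataSubmonoid A _ _).1 h1
    rw [← hJ.2]
    change algebraMap D K x ∈ s (coeSubmodule K J)
    by_cases hx0 : x = 0
    · simp [hx0]
    have hx' : algebraMap D K x ≠ 0 := by simpa using hx0
    have h2 : Ideal.span {x} * u.contentIdeal ≤ J := by
      rw [← contentIdeal_C_mul, contentIdeal_le_iff]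
      rw [mul_comm] at hxu
      exact Ideal.mem_map_C_iff.1 hxu
    have h3 := s.mono _ _ (IsLocalization.coeSubmodule_mono K h2)
    rw [← algebraMap_smul_coeSubmodule, s.map_smul _ _ hx', hu.2] at h3
    exact h3 ((algebraMap_mem_smul_iff hx0 _).2 (s.le_toFun _ (Submodule.one_le.1 le_rfl)))
  have hstrict : StrictMono fun I : {I : Ideal D // s.IsQuasiIdeal I} => φ I.1 := by
    intro I J h
    exact lt_of_le_not_ge (hmono h.le) fun h' => h.not_ge (hle _ _ I.2 h')
  exact hstrict.wellFoundedGT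

theorem isPruferMultiplicationDomain_of_isDedekindDomain_localization
    (s : SemistarOperation D K) [IsLocalization s.nagataSubmonoid A] [IsDedekindDomain A] :
    s.IsPruferMultiplicationDomain := by
  intro I hI hIfg
  obtain ⟨a, haI, ha⟩ := Submodule.exists_mem_ne_zero_of_ne_bot hI
  rw [isStarInvertible_coeSubmodule_iff _ ha haI, mem_finiteType_coeSubmodule_iff]
  set L : Ideal D := (Ideal.span {a}).colon (I : Set D) with hL
  set ι : D →+* A := (algebraMap D[X] A).comp C with hι
  have hinj : Function.Injective (algebraMap D[X] A) :=
    IsLocalization.injective A s.nagataSubmonoid_le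
  -- The Dedekind property enters here: containment of ideals is divisibility.
  obtain ⟨J, hJ⟩ : I.map ι ∣ Ideal.span {ι a} := by
    rw [Ideal.dvd_iff_le, Ideal.span_singleton_le_iff_mem]
    exact Ideal.mem_map_of_mem _ haI
  have hJL : J ≤ (L.map C).map (algebraMap D[X] A) := by
    intro z hz
    obtain ⟨⟨p, u⟩, hpu⟩ := IsLocalization.surj s.nagataSubmonoid z
    have hex : ∀ b ∈ I, ∃ v ∈ s.nagataSubmonoid, ∀ n, a ∣ (v * p).coeff n * b := by
      intro b hb
      have h1 : ι b * z ∈ Ideal.span {ι a} := hJ ▸ Ideal.mul_mem_mul (Ideal.mem_map_of_mem _ hb) hz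
      have h2 : algebraMap D[X] A (C b * p) ∈
          (Ideal.span {C a}).map (algebraMap D[X] A) := by
        rw [Ideal.map_span, Set.image_singleton, map_mul, ← hpu, ← mul_assoc]
        exact Ideal.mul_mem_right _ _ h1
      obtain ⟨v, hv, h3⟩ := (IsLocalization.algebraMap_mem_map_algebraMap_iff
        s.nagataSubmonoid A _ _).1 h2
      refine ⟨v, hv, fun n => ?_⟩
      have h4 := (C_dvd_iff_dvd_coeff _ _).1 (Ideal.mem_span_singleton.1 h3) n
      rwa [show v * (C b * p) = v * p * C b by ring, coeff_mul_C] at h4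
    -- Finite generation of `I` allows one denominator `v` for all `b ∈ I`, which puts `v * p` in
    -- `L[X]`.
    have hall : ∀ P : Ideal D, P.FG → P ≤ I →
        ∃ v ∈ s.nagataSubmonoid, ∀ b ∈ P, ∀ n, a ∣ (v * p).coeff n * b := by
      intro P hP
      induction P, hP using Submodule.fg_induction with
      | singleton x =>
        intro hx
        obtain ⟨v, hv, h⟩ := hex x (hx (Submodule.mem_span_singleton_self x))
        refine ⟨v, hv, fun b hb n => ?_⟩
        obtain ⟨c, rfl⟩ := Submodule.mem_span_singleton.1 hb
        rw [smul_eq_mul, mul_left_comm]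
        exact (h n).mul_left c
      | sup P Q _ _ hP hQ =>
        intro hPQ
        obtain ⟨v, hv, h⟩ := hP (le_sup_left.trans hPQ)
        obtain ⟨w, hw, h'⟩ := hQ (le_sup_right.trans hPQ)
        refine ⟨v * w, mul_mem hv hw, fun b hb n => ?_⟩
        obtain ⟨x, hx, y, hy, rfl⟩ := Submodule.mem_sup.1 hb
        have hdvd : ∀ (v w : D[X]) (x : D), (∀ n, a ∣ (v * p).coeff n * x) →
            ∀ n, a ∣ (w * v * p).coeff n * x := by
          intro v w x h n
          rw [← coeff_mul_C, mul_assoc, mul_assoc]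
          refine (C_dvd_iff_dvd_coeff _ _).1 (Dvd.dvd.mul_left ?_ w) n
          rw [C_dvd_iff_dvd_coeff, ← mul_assoc]
          intro m
          rw [coeff_mul_C]
          exact h m
        rw [mul_add]
        refine dvd_add ?_ (hdvd w v y (h' y hy) n)
        rw [mul_comm v w]
        exact hdvd v w x (h x hx) n
    obtain ⟨v, hv, hvI⟩ := hall I hIfg le_rfl
    have h5 : v * p ∈ L.map C := Ideal.mem_map_C_iff.2 fun n =>
      Submodule.mem_colon.2 fun b hb => Ideal.mem_span_singleton.2 (hvI b hb n)
    have h6 : z * (algebraMap D[X] A u * algebraMap D[X] A v) ∈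
        (L.map C).map (algebraMap D[X] A) := by
      have h7 := Ideal.mem_map_of_mem (algebraMap D[X] A) h5
      rwa [map_mul, ← hpu, mul_comm, mul_assoc] at h7
    exact (Ideal.mul_unit_mem_iff_mem _
      ((IsLocalization.map_units A u).mul (IsLocalization.map_units A ⟨v, hv⟩))).1 h6
  have h1 : algebraMap D[X] A (C a) ∈ ((I * L).map C).map (algebraMap D[X] A) := by
    have h2 : ι a ∈ I.map ι * J := hJ ▸ Ideal.mem_span_singleton_self _
    rw [Ideal.map_mul, Ideal.map_mul]
    refine Ideal.mul_mono ?_ hJL h2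
    rw [Ideal.map_map]
  obtain ⟨u, hu, hau⟩ := (IsLocalization.algebraMap_mem_map_algebraMap_iff
    s.nagataSubmonoid A _ _).1 h1
  rw [mul_comm u] at hau
  -- The finitely generated witness is `c(au) = a c(u) ⊆ I L`, whose closure `a D^⋆` contains `a`.
  refine ⟨_, (C a * u).contentIdeal_FG, contentIdeal_le_iff.2 (Ideal.mem_map_C_iff.1 hau), ?_⟩
  have ha' : algebraMap D K a ≠ 0 := by simpa using ha
  rw [contentIdeal_C_mul, ← algebraMap_smul_coeSubmodule, s.map_smul _ _ ha', hu.2,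
    algebraMap_mem_smul_iff ha]
  exact s.le_toFun _ (Submodule.one_le.1 le_rfl)

end Localization

/-! ### Comparison with the Kronecker function ring -/

theorem nagataRing_subset_kroneckerFunctionRing (s : SemistarOperation D K) :
    (s.nagataRing : Set (FractionRing D[X])) ⊆ s.kroneckerFunctionRing := by
  intro x hx
  obtain ⟨f, h, hh, rfl⟩ := (s.mem_nagataRing x).1 hx
  by_cases hf : f = 0
  · right
    simp [hf]
  · refine Or.inl ⟨f, h, hf, hh.1, rfl, 1, one_ne_zero, ?_⟩
    rw [contentIdeal_one, Ideal.mul_top, Ideal.mul_top, hh.2]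
    exact s.mono _ _ (coeSubmodule_le_one _)

/-- A `⋆_f`-invertible ideal can be cancelled in inclusions of `⋆`-closures. -/
theorem IsPruferMultiplicationDomain.le_of_mul_le_mul {s : SemistarOperation D K}
    (hs : s.IsPruferMultiplicationDomain) {I J H : Ideal D} (hH : H ≠ ⊥) (hHfg : H.FG)
    (h : s (coeSubmodule K (I * H)) ≤ s (coeSubmodule K (J * H))) :
    coeSubmodule K I ≤ s (coeSubmodule K J) := by
  have h1 : (1 : K) ∈ s (coeSubmodule K H * (1 / coeSubmodule K H)) := by
    have h2 := hs H hH hHfg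
    have h3 : (1 : K) ∈ s.finiteType (coeSubmodule K H * (1 / coeSubmodule K H)) :=
      (s.finiteType.toFun_eq_toFun_one_iff Submodule.mul_one_div_le_one).1 h2
    obtain ⟨F, -, hF, h4⟩ := h3
    exact s.mono _ _ hF h4
  set E := coeSubmodule K H
  set G : Submodule D K := 1 / E
  rw [IsLocalization.coeSubmodule_mul, IsLocalization.coeSubmodule_mul] at h
  -- Since `1 ∈ (E G)^⋆`, multiplying by `E G` loses nothing up to closure; the factor `E` is then
  -- traded through `h`, and `G` removes it again.
  have h2 : coeSubmodule K I ≤ s (coeSubmodule K I * (E * G)) := by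
    refine le_trans ?_ (s.mul_toFun_le _ _)
    intro x hx
    simpa using Submodule.mul_mem_mul hx h1
  refine h2.trans (s.toFun_le_iff.2 ?_)
  calc coeSubmodule K I * (E * G) = G * (coeSubmodule K I * E) := by ring
    _ ≤ G * s (coeSubmodule K J * E) := mul_le_mul' le_rfl (s.toFun_le_iff.1 h)
    _ ≤ s (G * (coeSubmodule K J * E)) := s.mul_toFun_le _ _
    _ ≤ s (coeSubmodule K J) := by
      refine s.mono _ _ ?_
      calc G * (coeSubmodule K J * E) = coeSubmodule K J * (E * G) := by ring
        _ ≤ coeSubmodule K J * 1 := mul_le_mul' le_rfl Submodule.mul_one_div_le_one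
        _ = coeSubmodule K J := mul_one _

theorem IsPruferMultiplicationDomain.kroneckerFunctionRing_subset {s : SemistarOperation D K}
    (hs : s.IsPruferMultiplicationDomain) :
    s.kroneckerFunctionRing ⊆ (s.nagataRing : Set (FractionRing D[X])) := by
  rintro x (⟨f, g, -, hg, rfl, h, hh, hle⟩ | hx)
  · have h1 := hs.le_of_mul_le_mul (mt (contentIdeal_eq_bot_iff h).1 hh) h.contentIdeal_FG hle
    obtain ⟨p, u, hu, hfu⟩ := hs.exists_mul_eq_mul hg h1
    refine (s.mem_nagataRing _).2 ⟨p, u, hu, ?_⟩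
    have hinj := IsFractionRing.injective D[X] (FractionRing D[X])
    have hg' : algebraMap D[X] (FractionRing D[X]) g ≠ 0 := by
      rwa [Ne, map_eq_zero_iff _ hinj]
    have hu' : algebraMap D[X] (FractionRing D[X]) u ≠ 0 := by
      rw [Ne, map_eq_zero_iff _ hinj]
      exact hu.1
    rw [div_eq_div_iff hg' hu', ← map_mul, ← map_mul, hfu]
  · rw [Set.mem_singleton_iff.1 hx]
    exact zero_mem s.nagataRing

end SemistarOperation

theorem theorem4p18 {D : Type u} [CommRing D] [IsDomain D]
    {K : Type v} [Field K] [Algebra D K] [IsFractionRing D K]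
    (s : SemistarOperation D K) :
    List.TFAE
      [s.IsStarDedekind,
        IsDomain s.nagataRing ∧ IsPrincipalIdealRing s.nagataRing,
        IsDedekindDomain s.nagataRing] ∧
      (s.IsStarDedekind →
        (s.nagataRing : Set (FractionRing D[X])) = s.kroneckerFunctionRing) := by
  have := s.isLocalization_nagataRing
  refine ⟨?_, fun hs => s.nagataRing_subset_kroneckerFunctionRing.antisymm
    hs.2.kroneckerFunctionRing_subset⟩
  tfae_have 1 → 2 := fun hs => ⟨inferInstance, hs.isPrincipalIdealRing_localization s.nagataRing⟩
  tfae_have 2 → 3 := by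
    rintro ⟨_, _⟩
    infer_instance
  tfae_have 3 → 1 := fun _ =>
    ⟨s.isStarNoetherian_of_isNoetherianRing_localization s.nagataRing,
      s.isPruferMultiplicationDomain_of_isDedekindDomain_localization s.nagataRing⟩
  tfae_finish
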